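/- A compact system $(X,f)$ is a compact metric space $(X,d)$ with a continuous map $f:X\to X$. It is Devaney chaotic if (1) $f$ is transitive: for all non-empty open $U,V\subseteq X$ there is $n\ge 0$ with $f^n(U)\cap V\neq\emptyset$; (2) the periodic points of $f$ are dense in $X$; and (3) $f$ is sensitive: there is $\delta>0$ such that for every $x\in X$ and every neighbourhood $V$ of $x$ there are $y\in V$ and $n\ge 0$ with $d(f^n(x),f^n(y))>\delta$. The map $f$ is mixing if for all non-empty open $U,V$ there is $N$ with $f^n(U)\cap V\ne\emptyset$ for all $n\ge N$. The hyperspace system $(\mathcal K(X),\overline f)$ consists of the set $\mathcal K(X)$ of non-empty compact subsets of $X$ with the Hausdorff metric and the map $\overline f(A)=f(A)$. For $k\ge 1$ let $\Sigma_k=\{0,\dots,k-1\}^{\{0,1,2,\dots\}}$, with the metric $\rho(x,y)=\frac1{m+1}$ for $x\ne y$, where $m=\min\{n\ge 0: x_n\neq y_n\}$, and let $\sigma(x_0x_1x_2\cdots)=x_1x_2\cdots$ be the shift. A mixing non-trivial minimal subshift of $\Sigma_2$ is a closed set $X\subseteq\Sigma_2$ with more than one point and with $\sigma(X)\subseteq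 X$, such that the forward orbit of every point of $X$ is dense in $X$ and $\sigma|_X$ is mixing. For $b=b_0b_1\cdots\in X$ let $X_b\subseteq\Sigma_3$ be the set of all $x=x_0x_1\cdots$ for which there are $n_0<n_1<n_2<\cdots$ in $\{0,1,2,\dots\}$ with $x_{n_i}=b_i$ for all $i$, and $x_n=2$ whenever $n\notin\{n_0,n_1,\dots\}$. Put $\widetilde X=\overline{\bigcup_{b\in X}X_b}\subseteq\Sigma_3$. **Theorem.** Mixing non-trivial minimal subshifts of $\Sigma_2$ exist, and for every such subshift $X$, $(\widetilde X,\sigma)$ is a compact system whose hyperspace system $(\mathcal K(\widetilde X),\overline\sigma)$ is Devaney chaotic, while $(\widetilde X,\sigma)$ itself is not Devaney chaotic. In particular, the hyperspace system being Devaney chaotic does not imply that the base system is Devaney chaotic. -/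

import Mathlib

open Set TopologicalSpace

noncomputable section

namespace HyperChaos

/-! ### Compact systems and Devaney chaos -/

/-- A compact system: a compact metric space with a continuous self-map. -/
structure IsCompactSystem {X : Type*} [MetricSpace X] (f : X → X) : Prop where
  compact : CompactSpace X
  continuous : Continuous f

/-- Topological transitivity. -/
def IsTransitive {X : Type*} [TopologicalSpace X] (f : X → X) : Prop :=
  ∀ U V : Set X, IsOpen U → IsOpen V → U.Nonempty → V.Nonempty →
    ∃ n : ℕ, (f^[n] '' U ∩ V).Nonempty

/-- The periodic points of `f` (points `x` with `f^n x = x` for some `n ≥ 1`) are dense. -/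
def IsPeriodicallyDense {X : Type*} [TopologicalSpace X] (f : X → X) : Prop :=
  Dense (Function.periodicPts f)

/-- Sensitive dependence on initial conditions. -/
def IsSensitive {X : Type*} [MetricSpace X] (f : X → X) : Prop :=
  ∃ δ : ℝ, 0 < δ ∧ ∀ x : X, ∀ V : Set X, IsOpen V → x ∈ V →
    ∃ y ∈ V, ∃ n : ℕ, δ < dist (f^[n] x) (f^[n] y)

/-- Devaney chaos: transitive, periodically dense and sensitive. -/
structure IsDevaneyChaotic {X : Type*} [MetricSpace X] (f : X → X) : Prop where
  transitive : IsTransitive f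
  periodicallyDense : IsPeriodicallyDense f
  sensitive : IsSensitive f

/-- Topological mixing. -/
def IsMixing {X : Type*} [TopologicalSpace X] (f : X → X) : Prop :=
  ∀ U V : Set X, IsOpen U → IsOpen V → U.Nonempty → V.Nonempty →
    ∃ N : ℕ, ∀ n ≥ N, (f^[n] '' U ∩ V).Nonempty

/-- A set is minimal for `f` if it is nonempty and is the closure of the forward orbit of each of
its points. -/
def IsMinimalSet {X : Type*} [TopologicalSpace X] (f : X → X) (A : Set X) : Prop :=
  A.Nonempty ∧ ∀ x ∈ A, closure (range fun n : ℕ => f^[n] x) = A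

/-- The hyperspace map `K ↦ f(K)` on the nonempty compact subsets of `X`; Mathlib equips
`NonemptyCompacts X` with the Hausdorff metric, whose topology is the Vietoris topology. -/
def hyperMap {X : Type*} [MetricSpace X] (f : X → X) (hf : Continuous f) :
    NonemptyCompacts X → NonemptyCompacts X :=
  NonemptyCompacts.map f hf

/-! ### Symbol spaces -/

/-- The symbol space `Σ_k` of one-sided sequences over `{0, …, k - 1}`. -/
def SymbSpace (k : ℕ) : Type := ℕ → Fin k

namespace SymbSpace

variable {k : ℕ}

/-- The product topology of the discrete topologies; the metric below induces it. -/
instance : TopologicalSpace (SymbSpace k) := inferInstanceAs (TopologicalSpace (ℕ → Fin k))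

instance : CompactSpace (SymbSpace k) := inferInstanceAs (CompactSpace (ℕ → Fin k))

/-- `ρ(x, y) = 1 / (m + 1)`, where `m` is the first index at which `x` and `y` differ. -/
def rho (x y : SymbSpace k) : ℝ :=
  open Classical in if x = y then 0 else 1 / ((sInf {n : ℕ | x n ≠ y n} : ℕ) + 1 : ℝ)

theorem rho_lt_iff (x y : SymbSpace k) (n : ℕ) :
    rho x y < 1 / (n + 1 : ℝ) ↔ ∀ i ≤ n, x i = y i := by
  unfold rho
  split_ifs with h
  · subst h
    simp only [implies_true, iff_true]
    positivity
  · have hne : {n : ℕ | x n ≠ y n}.Nonempty := by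
      by_contra hc
      apply h
      funext i
      by_contra hi
      exact hc ⟨i, hi⟩
    rw [one_div_lt_one_div (by positivity) (by positivity), add_lt_add_iff_right, Nat.cast_lt]
    constructor
    · intro hn i hi
      by_contra hxy
      have := Nat.sInf_le (s := {n : ℕ | x n ≠ y n}) hxy
      omega
    · intro H
      by_contra hn
      exact Nat.sInf_mem hne (H _ (not_lt.mp hn))

theorem rho_nonneg (x y : SymbSpace k) : 0 ≤ rho x y := by
  unfold rho
  split_ifs
  · exact le_rfl
  · positivity

theorem rho_self (x : SymbSpace k) : rho x x = 0 := by simp [rho]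

theorem rho_comm (x y : SymbSpace k) : rho x y = rho y x := by
  by_cases h : x = y
  · rw [h]
  · unfold rho
    rw [if_neg h, if_neg (Ne.symm h)]
    simp only [ne_comm (a := x _) (b := y _)]

theorem eq_of_rho_eq_zero (x y : SymbSpace k) (h : rho x y = 0) : x = y := by
  funext i
  exact (rho_lt_iff x y i).1 (by rw [h]; positivity) i le_rfl

theorem rho_triangle (x y z : SymbSpace k) : rho x z ≤ rho x y + rho y z := by
  by_cases hxz : x = z
  · subst hxz
    rw [rho_self]
    exact add_nonneg (rho_nonneg _ _) (rho_nonneg _ _)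
  have hval : rho x z = 1 / ((sInf {n : ℕ | x n ≠ z n} : ℕ) + 1 : ℝ) := by
    unfold rho
    rw [if_neg hxz]
  by_contra hlt
  rw [not_le] at hlt
  have h1 : rho x y < rho x z := by linarith [rho_nonneg y z]
  have h2 : rho y z < rho x z := by linarith [rho_nonneg x y]
  rw [hval, rho_lt_iff] at h1 h2
  have h3 : rho x z < rho x z := by
    conv_rhs => rw [hval]
    rw [rho_lt_iff]
    exact fun i hi => (h1 i hi).trans (h2 i hi)
  exact lt_irrefl _ h3

theorem isOpen_iff_rho (s : Set (SymbSpace k)) :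
    IsOpen s ↔ ∀ x ∈ s, ∃ ε > 0, ∀ y, rho x y < ε → y ∈ s := by
  have hbasis := PiNat.isTopologicalBasis_cylinders (fun _ : ℕ => Fin k)
  constructor
  · intro hs x hx
    obtain ⟨v, ⟨y, n, rfl⟩, hxv, hvs⟩ := hbasis.exists_subset_of_mem_open hx hs
    refine ⟨1 / (n + 1 : ℝ), by positivity, fun z hz => hvs ?_⟩
    rw [rho_lt_iff] at hz
    intro i hi
    rw [← hz i hi.le]
    exact hxv i hi
  · intro H
    refine hbasis.isOpen_iff.2 fun x hx => ?_
    obtain ⟨ε, hε, hs⟩ := H x hx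
    obtain ⟨n, hn⟩ := exists_nat_one_div_lt hε
    refine ⟨PiNat.cylinder x (n + 1), ⟨x, n + 1, rfl⟩, PiNat.self_mem_cylinder _ _, ?_⟩
    intro y hy
    refine hs y (lt_trans ((rho_lt_iff x y n).2 fun i hi => ?_) hn)
    exact (hy i (Nat.lt_succ_of_le hi)).symm

/-- `Σ_k` with the metric `ρ`. -/
instance : MetricSpace (SymbSpace k) :=
  MetricSpace.ofDistTopology rho rho_self rho_comm rho_triangle isOpen_iff_rho eq_of_rho_eq_zero

end SymbSpace

/-- The shift map `σ(x₀x₁x₂…) = x₁x₂…`. -/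
def shift {k : ℕ} (x : SymbSpace k) : SymbSpace k := fun n => x (n + 1)

theorem continuous_shift {k : ℕ} : Continuous (shift : SymbSpace k → SymbSpace k) :=
  continuous_pi (A := fun _ : ℕ => Fin k) fun n => continuous_apply (n + 1)

/-- The restriction of the shift to a shift-invariant set. -/
def subshiftMap {k : ℕ} {Y : Set (SymbSpace k)} (hY : MapsTo shift Y Y) : Y → Y :=
  hY.restrict shift Y Y

theorem continuous_subshiftMap {k : ℕ} {Y : Set (SymbSpace k)} (hY : MapsTo shift Y Y) :
    Continuous (subshiftMap hY) :=
  continuous_shift.restrict hY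

/-- `X` is a mixing non-trivial minimal subshift of `Σ_k`. Non-trivial means that `X` has more
than one point; since a finite mixing system has at most one point, `X` is then infinite. -/
structure IsMixingNontrivialMinimalSubshift {k : ℕ} (X : Set (SymbSpace k)) : Prop where
  isClosed : IsClosed X
  mapsTo : MapsTo shift X X
  minimal : IsMinimalSet shift X
  nontrivial : X.Nontrivial
  mixing : IsMixing (subshiftMap mapsTo)

/-! ### The construction -/

/-- The extension `X_b ⊆ Σ₃` of `b ∈ Σ₂`: all sequences obtained by writing the symbols of `b` in
order at positions `n₀ < n₁ < …` and the symbol `2` at all other positions. -/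
def extension (b : SymbSpace 2) : Set (SymbSpace 3) :=
  {x | ∃ n : ℕ → ℕ, StrictMono n ∧ (∀ i, x (n i) = (b i).castSucc) ∧ ∀ m, m ∉ range n → x m = 2}

/-- The space `X̃ = closure (⋃ b ∈ X, X_b) ⊆ Σ₃`. -/
def tilde (X : Set (SymbSpace 2)) : Set (SymbSpace 3) :=
  closure (⋃ b ∈ X, extension b)

theorem shift_mem_extension {b : SymbSpace 2} {x : SymbSpace 3} (hx : x ∈ extension b) :
    shift x ∈ extension b ∨ shift x ∈ extension (shift b) := by
  obtain ⟨n, hn, hb, h2⟩ := hx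
  by_cases h0 : n 0 = 0
  · right
    have hpos : ∀ i, 0 < n (i + 1) := fun i => by
      have h1 : n 0 < n (i + 1) := hn (Nat.succ_pos i)
      omega
    refine ⟨fun i => n (i + 1) - 1, fun i j hij => ?_, fun i => ?_, fun m hm => h2 (m + 1) ?_⟩
    · have h1 : n (i + 1) < n (j + 1) := hn (Nat.succ_lt_succ hij)
      have h2 := hpos i
      simp only
      omega
    · change x (n (i + 1) - 1 + 1) = _
      rw [Nat.sub_add_cancel (hpos i), hb]
      rfl
    · rintro ⟨i, hi⟩
      cases i with
      | zero => omega
      | succ i => exact hm ⟨i, by simp only; omega⟩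
  · left
    have hpos : ∀ i, 0 < n i := fun i => by
      have := hn.monotone (Nat.zero_le i)
      omega
    refine ⟨fun i => n i - 1, fun i j hij => ?_, fun i => ?_, fun m hm => h2 (m + 1) ?_⟩
    · have := hn hij
      have := hpos i
      simp only
      omega
    · change x (n i - 1 + 1) = _
      rw [Nat.sub_add_cancel (hpos i), hb]
    · rintro ⟨i, hi⟩
      exact hm ⟨i, by simp only; omega⟩

theorem mapsTo_shift_tilde {X : Set (SymbSpace 2)} (hX : MapsTo shift X X) :
    MapsTo shift (tilde X) (tilde X) := by
  refine MapsTo.closure (fun x hx => ?_) continuous_shift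
  simp only [mem_iUnion, exists_prop] at hx ⊢
  obtain ⟨b, hb, hx⟩ := hx
  rcases shift_mem_extension hx with h | h
  · exact ⟨b, hb, h⟩
  · exact ⟨shift b, hX hb, h⟩

/-- The system `(X̃, σ)`. -/
def tildeShift {X : Set (SymbSpace 2)} (hX : MapsTo shift X X) : tilde X → tilde X :=
  subshiftMap (mapsTo_shift_tilde hX)

theorem continuous_tildeShift {X : Set (SymbSpace 2)} (hX : MapsTo shift X X) :
    Continuous (tildeShift hX) :=
  continuous_subshiftMap _

end HyperChaos

end

/-! Deleting the symbol `2` governs $\widetilde X$: a word is in its language iff the remaining word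
is in the language of $X$ (`mem_lang_tilde_iff`). In a minimal $X$ every word $v$ recurs with
bounded gaps, so $v$ can follow any word $u$ after a filler of bounded length; padding the filler
with `2`s gives every larger length. The bound depends on $v$ alone (`HasUniformGluing`). Hence
$\sigma$ is mixing on $\widetilde X$, and the hyperspace map is mixing and so sensitive. Moreover
any word can be made to recur at all multiples of some $n$, so every open set contains a closed set
invariant under $\sigma^n$, and inside it one mapped onto itself. Finite unions of these are the
dense periodic points of the hyperspace. A periodic point of $\widetilde X$ not starting with `2`
would yield a periodic point of $X$ by deletion. A non-trivial mixing minimal subshift has none, so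
density of periodic points fails on $\widetilde X$. For existence, two blocks per level, of lengths
$\ell$ and $\ell+1$, are built from long runs of the previous two. Each block contains the previous
first block, which gives minimality; the length difference of one lets all large distances between
blocks occur (`blocksAtDistance`), which gives mixing. -/

namespace HyperChaos

/-! ### Mixing and dense periodic points in the hyperspace -/

section Hyperspace

theorem IsMixing.isTransitive {X : Type*} [TopologicalSpace X] {f : X → X} (h : IsMixing f) :
    IsTransitive f := fun U V hU hV hU' hV' =>
  let ⟨N, hN⟩ := h U V hU hV hU' hV'
  ⟨N, hN N le_rfl⟩

/-- A mixing map on a metric space with at least two points is sensitive. -/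
theorem IsMixing.isSensitive {X : Type*} [MetricSpace X] [Nontrivial X] {f : X → X}
    (h : IsMixing f) : IsSensitive f := by
  obtain ⟨p, q, hpq⟩ := exists_pair_ne X
  have hd : 0 < dist p q := dist_pos.2 hpq
  -- At a common time `V` reaches the quarter-balls around `p` and `q`; if both image points were
  -- also within a quarter of the image of `x`, then `dist p q < dist p q`.
  refine ⟨dist p q / 4, by positivity, fun x V hV hx => ?_⟩
  obtain ⟨N, hN⟩ := h V (Metric.ball p (dist p q / 4)) hV Metric.isOpen_ball ⟨x, hx⟩
    ⟨p, Metric.mem_ball_self (by positivity)⟩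
  obtain ⟨M, hM⟩ := h V (Metric.ball q (dist p q / 4)) hV Metric.isOpen_ball ⟨x, hx⟩
    ⟨q, Metric.mem_ball_self (by positivity)⟩
  obtain ⟨_, ⟨y, hy, rfl⟩, hyp⟩ := hN (max N M) (le_max_left _ _)
  obtain ⟨_, ⟨z, hz, rfl⟩, hzq⟩ := hM (max N M) (le_max_right _ _)
  rw [Metric.mem_ball] at hyp hzq
  by_contra! hcon
  have h1 := hcon y hy (max N M)
  have h2 := hcon z hz (max N M)
  generalize f^[max N M] x = x' at *
  generalize f^[max N M] y = y' at *
  generalize f^[max N M] z = z' at *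
  have h3 := dist_triangle4 p y' x' z'
  have h4 := dist_triangle p z' q
  rw [dist_comm] at hyp
  rw [dist_comm] at h1
  linarith

variable {X : Type*} [MetricSpace X]

theorem coe_iterate_hyperMap {f : X → X} (hf : Continuous f) (n : ℕ) (K : NonemptyCompacts X) :
    (((hyperMap f hf)^[n] K : NonemptyCompacts X) : Set X) = f^[n] '' K := by
  induction n with
  | zero => simp
  | succ n ih =>
    rw [Function.iterate_succ_apply', Function.iterate_succ', image_comp, ← ih]
    rfl

/-- Every neighbourhood of a compact set contains all the compact sets which are close to some
finite set. -/
theorem exists_finset_of_isOpen_nonemptyCompacts {𝒰 : Set (NonemptyCompacts X)} (h𝒰 : IsOpen 𝒰)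
    (hne : 𝒰.Nonempty) :
    ∃ F : Finset X, F.Nonempty ∧ ∃ ε > 0, ∀ L : NonemptyCompacts X,
      (∀ y ∈ L, ∃ x ∈ F, dist y x < ε) → (∀ x ∈ F, ∃ y ∈ L, dist y x < ε) → L ∈ 𝒰 := by
  obtain ⟨K, hK⟩ := hne
  obtain ⟨ε, hε, hball⟩ := Metric.isOpen_iff.1 h𝒰 K hK
  obtain ⟨F, hFK, hF, hcov⟩ := K.isCompact.finite_cover_balls (e := ε / 4) (by positivity)
  lift F to Finset X using hF
  refine ⟨F, ?_, ε / 4, by positivity, fun L h1 h2 => hball ?_⟩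
  · obtain ⟨y, hy⟩ := K.nonempty
    obtain ⟨x, hx, -⟩ := mem_iUnion₂.1 (hcov hy)
    exact ⟨x, hx⟩
  · rw [Metric.mem_ball, Metric.NonemptyCompacts.dist_eq]
    refine lt_of_le_of_lt (Metric.hausdorffDist_le_of_mem_dist (r := ε / 2) (by positivity) ?_ ?_)
      (by linarith)
    · intro y hy
      obtain ⟨x, hx, hyx⟩ := h1 y hy
      exact ⟨x, hFK hx, by linarith⟩
    · intro y hy
      obtain ⟨x, hx, hyx⟩ := mem_iUnion₂.1 (hcov hy)
      obtain ⟨z, hz, hzx⟩ := h2 x hx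
      refine ⟨z, hz, ?_⟩
      rw [Metric.mem_ball] at hyx
      have := dist_triangle_right y z x
      linarith

/-- A mixing map induces a mixing map on the hyperspace. -/
theorem IsMixing.hyperMap {f : X → X} (hf : Continuous f) (h : IsMixing f) :
    IsMixing (hyperMap f hf) := by
  intro 𝒰 𝒱 h𝒰 h𝒱 h𝒰' h𝒱'
  obtain ⟨F, hF, ε, hε, hL⟩ := exists_finset_of_isOpen_nonemptyCompacts h𝒰 h𝒰'
  obtain ⟨G, hG, η, hη, hM⟩ := exists_finset_of_isOpen_nonemptyCompacts h𝒱 h𝒱'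
  have hball : ∀ p : X × X, ∃ N : ℕ, ∀ n ≥ N,
      (f^[n] '' Metric.ball p.1 ε ∩ Metric.ball p.2 η).Nonempty := fun p =>
    h _ _ Metric.isOpen_ball Metric.isOpen_ball ⟨_, Metric.mem_ball_self hε⟩
      ⟨_, Metric.mem_ball_self hη⟩
  choose N hN using hball
  -- One point `z p` for each pair `p` travels from near `p.1` to near `p.2` in the same time `n`;
  -- the finite set of these points is close to `F` and its image is close to `G`.
  refine ⟨(F ×ˢ G).sup N, fun n hn => ?_⟩
  obtain ⟨x₀, hx₀⟩ := hF
  obtain ⟨y₀, hy₀⟩ := hG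
  have : Nonempty X := ⟨x₀⟩
  have hz : ∀ p ∈ F ×ˢ G, ∃ z, dist z p.1 < ε ∧ dist (f^[n] z) p.2 < η := fun p hp => by
    obtain ⟨_, ⟨z, hz, rfl⟩, hz'⟩ := hN p n ((Finset.le_sup hp).trans hn)
    exact ⟨z, hz, hz'⟩
  choose! z hz1 hz2 using hz
  let L : NonemptyCompacts X :=
    ⟨⟨z '' ((F ×ˢ G : Finset (X × X)) : Set (X × X)), ((F ×ˢ G).finite_toSet.image z).isCompact⟩,
      ⟨_, (x₀, y₀), Finset.mem_coe.2 (Finset.mk_mem_product hx₀ hy₀), rfl⟩⟩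
  have hLmem : ∀ y, y ∈ L ↔ ∃ p ∈ F ×ˢ G, z p = y := fun y => Iff.rfl
  refine ⟨_, ⟨L, hL L ?_ ?_, rfl⟩, hM _ ?_ ?_⟩
  · intro y hy
    obtain ⟨p, hp, rfl⟩ := (hLmem y).1 hy
    exact ⟨p.1, (Finset.mem_product.1 hp).1, hz1 p hp⟩
  · intro x hx
    exact ⟨_, (hLmem _).2 ⟨(x, y₀), Finset.mk_mem_product hx hy₀, rfl⟩,
      hz1 _ (Finset.mk_mem_product hx hy₀)⟩
  · intro y hy
    rw [← SetLike.mem_coe, coe_iterate_hyperMap] at hy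
    obtain ⟨w, hw, rfl⟩ := hy
    obtain ⟨p, hp, rfl⟩ := (hLmem w).1 hw
    exact ⟨p.2, (Finset.mem_product.1 hp).2, hz2 p hp⟩
  · intro y hy
    refine ⟨f^[n] (z (x₀, y)), ?_, hz2 _ (Finset.mk_mem_product hx₀ hy)⟩
    rw [← SetLike.mem_coe, coe_iterate_hyperMap]
    exact ⟨_, (hLmem _).2 ⟨(x₀, y), Finset.mk_mem_product hx₀ hy, rfl⟩, rfl⟩

/-- A forward invariant nonempty closed subset of a compact space contains a nonempty closed set
which is mapped onto itself. -/
theorem exists_isClosed_image_eq [CompactSpace X] {g : X → X} (hg : Continuous g) {A : Set X}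
    (hA : IsClosed A) (hne : A.Nonempty) (hgA : MapsTo g A A) :
    ∃ K ⊆ A, IsClosed K ∧ K.Nonempty ∧ g '' K = K := by
  have hcl : ∀ i, IsClosed (g^[i] '' A) := fun i =>
    (hA.isCompact.image (hg.iterate i)).isClosed
  have hanti : ∀ i, g^[i + 1] '' A ⊆ g^[i] '' A := fun i => by
    rw [Function.iterate_succ, image_comp]
    exact image_mono hgA.image_subset
  refine ⟨⋂ i, g^[i] '' A, ?_, isClosed_iInter hcl, ?_, ?_⟩
  · exact (iInter_subset _ 0).trans (by simp)
  · exact IsCompact.nonempty_iInter_of_sequence_nonempty_isCompact_isClosed _ hanti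
      (fun i => hne.image _) (hcl 0).isCompact hcl
  · apply Subset.antisymm
    · rintro _ ⟨x, hx, rfl⟩
      refine mem_iInter.2 fun i => hanti i ?_
      rw [Function.iterate_succ', image_comp]
      exact mem_image_of_mem g (mem_iInter.1 hx i)
    -- Preimages of `y` in the sets `g^[i] '' A` form a decreasing sequence of nonempty compact
    -- sets, so one preimage lies in all of them.
    · intro y hy
      have hcl' : ∀ i, IsClosed (g^[i] '' A ∩ g ⁻¹' {y}) := fun i =>
        (hcl i).inter (isClosed_singleton.preimage hg)
      obtain ⟨x, hx⟩ := IsCompact.nonempty_iInter_of_sequence_nonempty_isCompact_isClosed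
        (fun i => g^[i] '' A ∩ g ⁻¹' {y}) (fun i => inter_subset_inter_left _ (hanti i))
        (fun i => by
          have := mem_iInter.1 hy (i + 1)
          rw [Function.iterate_succ', image_comp] at this
          obtain ⟨x, hx, hxy⟩ := this
          exact ⟨x, hx, hxy⟩) (hcl' 0).isCompact hcl'
      rw [mem_iInter] at hx
      exact ⟨x, mem_iInter.2 fun i => (hx i).1, (hx 0).2⟩

/-- If every nonempty open set contains a nonempty closed set which is forward invariant under a
positive iterate, then the hyperspace map has dense periodic points. -/
theorem isPeriodicallyDense_hyperMap [CompactSpace X] {f : X → X} (hf : Continuous f)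
    (h : ∀ U : Set X, IsOpen U → U.Nonempty →
      ∃ n > 0, ∃ A ⊆ U, IsClosed A ∧ A.Nonempty ∧ MapsTo f^[n] A A) :
    IsPeriodicallyDense (hyperMap f hf) := by
  refine dense_iff_inter_open.2 fun 𝒰 h𝒰 h𝒰' => ?_
  obtain ⟨F, hF, ε, hε, hL⟩ := exists_finset_of_isOpen_nonemptyCompacts h𝒰 h𝒰'
  have hper : ∀ x : X, ∃ n > 0, ∃ K ⊆ Metric.ball x ε, IsClosed K ∧ K.Nonempty ∧
      f^[n] '' K = K := fun x => by
    obtain ⟨n, hn, A, hAU, hA, hne, hmaps⟩ :=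
      h (Metric.ball x ε) Metric.isOpen_ball ⟨x, Metric.mem_ball_self hε⟩
    obtain ⟨K, hKA, hK⟩ := exists_isClosed_image_eq (hf.iterate n) hA hne hmaps
    exact ⟨n, hn, K, hKA.trans hAU, hK⟩
  choose n hn K hKball hKcl hKne hKn using hper
  let L : NonemptyCompacts X :=
    ⟨⟨⋃ x ∈ F, K x, F.isCompact_biUnion fun x _ => (hKcl x).isCompact⟩, by
      obtain ⟨x, hx⟩ := hF
      obtain ⟨y, hy⟩ := hKne x
      exact ⟨y, mem_biUnion hx hy⟩⟩
  have hLcoe : (L : Set X) = ⋃ x ∈ F, K x := rfl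
  refine ⟨L, hL L ?_ ?_, ?_⟩
  · intro y hy
    obtain ⟨x, hx, hyx⟩ := mem_iUnion₂.1 (hLcoe ▸ SetLike.mem_coe.2 hy)
    exact ⟨x, hx, hKball x hyx⟩
  · intro x hx
    obtain ⟨y, hy⟩ := hKne x
    refine ⟨y, SetLike.mem_coe.1 (hLcoe ▸ mem_biUnion hx hy), hKball x hy⟩
  · refine Function.mk_mem_periodicPts (n := ∏ x ∈ F, n x) (Finset.prod_pos fun x _ => hn x) ?_
    refine SetLike.coe_injective ?_
    rw [coe_iterate_hyperMap, hLcoe, image_iUnion₂]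
    refine iUnion₂_congr fun x hx => ?_
    obtain ⟨m, hm⟩ := Finset.dvd_prod_of_mem n hx
    rw [hm, Function.iterate_mul]
    clear hm
    induction m with
    | zero => simp
    | succ m ih => rw [Function.iterate_succ, image_comp, hKn, ih]

end Hyperspace

/-! ### Languages of subshifts and uniform gluing -/

section Words

variable {k : ℕ}

/-- The prefix of length `n` of the sequence `x`. -/
def word (x : SymbSpace k) (n : ℕ) : List (Fin k) := (List.range n).map fun i => x i

@[simp] theorem length_word (x : SymbSpace k) (n : ℕ) : (word x n).length = n := by simp [word]

theorem iterate_shift_apply (x : SymbSpace k) (m i : ℕ) : shift^[m] x i = x (m + i) := by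
  induction m generalizing x with
  | zero => simp
  | succ m ih =>
    rw [Function.iterate_succ_apply, ih]
    simp only [shift]
    congr 1
    omega

theorem word_add (x : SymbSpace k) (m n : ℕ) :
    word x (m + n) = word x m ++ word (shift^[m] x) n := by
  simp only [word, List.range_add, List.map_append, List.map_map]
  congr 1
  refine List.map_congr_left fun i _ => ?_
  rw [iterate_shift_apply]
  rfl

theorem word_succ (x : SymbSpace k) (n : ℕ) : word x (n + 1) = x 0 :: word (shift x) n := by
  rw [Nat.add_comm, word_add]
  rfl

theorem word_succ' (x : SymbSpace k) (n : ℕ) : word x (n + 1) = word x n ++ [x n] := by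
  simp [word, List.range_succ]

theorem word_eq_iff {x y : SymbSpace k} {n : ℕ} : word x n = word y n ↔ ∀ i < n, x i = y i := by
  simp [word]

theorem word_eq_of_le {x y : SymbSpace k} {m n : ℕ} (hmn : m ≤ n) (h : word x n = word y n) :
    word x m = word y m :=
  word_eq_iff.2 fun i hi => word_eq_iff.1 h i (hi.trans_le hmn)

theorem word_prefix {m n : ℕ} (x : SymbSpace k) (hmn : m ≤ n) : word x m <+: word x n := by
  obtain ⟨d, rfl⟩ := Nat.exists_eq_add_of_le hmn
  exact ⟨_, (word_add x m d).symm⟩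

theorem isOpen_word_mem (n : ℕ) (S : Set (List (Fin k))) :
    IsOpen {x : SymbSpace k | word x n ∈ S} := by
  refine (SymbSpace.isOpen_iff_rho _).2 fun x hx => ⟨1 / (n + 1 : ℝ), by positivity, fun y hy => ?_⟩
  rw [SymbSpace.rho_lt_iff] at hy
  have : word x n = word y n := word_eq_iff.2 fun i hi => hy i hi.le
  rwa [mem_ofPred_eq, ← this]

theorem isClosed_word_mem (n : ℕ) (S : Set (List (Fin k))) :
    IsClosed {x : SymbSpace k | word x n ∈ S} :=
  ⟨isOpen_word_mem n Sᶜ⟩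

theorem exists_word_subset_of_isOpen {U : Set (SymbSpace k)} (hU : IsOpen U) {x : SymbSpace k}
    (hx : x ∈ U) : ∃ n, ∀ y, word y n = word x n → y ∈ U := by
  obtain ⟨ε, hε, h⟩ := (SymbSpace.isOpen_iff_rho U).1 hU x hx
  obtain ⟨n, hn⟩ := exists_nat_one_div_lt hε
  refine ⟨n + 1, fun y hy => h y (lt_trans ((SymbSpace.rho_lt_iff x y n).2 fun i hi => ?_) hn)⟩
  exact (word_eq_iff.1 hy i (Nat.lt_succ_of_le hi)).symm

theorem mem_closure_iff_word {S : Set (SymbSpace k)} {x : SymbSpace k} :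
    x ∈ closure S ↔ ∀ n, ∃ y ∈ S, word y n = word x n := by
  constructor
  · intro hx n
    obtain ⟨y, hy, hyS⟩ := mem_closure_iff.1 hx _ (isOpen_word_mem n {word x n}) rfl
    exact ⟨y, hyS, hy⟩
  · refine fun h => mem_closure_iff.2 fun U hU hxU => ?_
    obtain ⟨n, hn⟩ := exists_word_subset_of_isOpen hU hxU
    obtain ⟨y, hyS, hy⟩ := h n
    exact ⟨y, hn y hy, hyS⟩

/-- The words which are prefixes of points of `Y`. -/
def lang (Y : Set (SymbSpace k)) : Set (List (Fin k)) := {u | ∃ x ∈ Y, word x u.length = u}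

theorem word_mem_lang {Y : Set (SymbSpace k)} {x : SymbSpace k} (hx : x ∈ Y) (n : ℕ) :
    word x n ∈ lang Y := ⟨x, hx, by rw [length_word]⟩

theorem mem_lang_iff {Y : Set (SymbSpace k)} {u : List (Fin k)} :
    u ∈ lang Y ↔ ∃ x ∈ Y, ∃ n, word x n = u :=
  ⟨fun ⟨x, hx, h⟩ => ⟨x, hx, _, h⟩, fun ⟨_, hx, n, h⟩ => h ▸ word_mem_lang hx n⟩

/-- Split a prefix along a decomposition. -/
theorem word_eq_append {x : SymbSpace k} {n : ℕ} {u v : List (Fin k)} (h : word x n = u ++ v) :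
    word x u.length = u ∧ word (shift^[u.length] x) v.length = v := by
  have hn : n = u.length + v.length := by
    rw [← length_word x n, h, List.length_append]
  rw [hn, word_add] at h
  exact List.append_inj h (length_word _ _)

theorem mem_of_forall_word_mem_lang {Y : Set (SymbSpace k)} (hY : IsClosed Y) {x : SymbSpace k}
    (h : ∀ n, word x n ∈ lang Y) : x ∈ Y := by
  rw [← hY.closure_eq, mem_closure_iff_word]
  intro n
  obtain ⟨y, hy, hyn⟩ := h n
  rw [length_word] at hyn
  exact ⟨y, hy, hyn⟩

theorem mapsTo_iterate_shift {Y : Set (SymbSpace k)} (hY : MapsTo shift Y Y) (n : ℕ)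
    {x : SymbSpace k} (hx : x ∈ Y) : shift^[n] x ∈ Y := hY.iterate n hx

theorem lang_of_infix {Y : Set (SymbSpace k)} (hY : MapsTo shift Y Y) {u v : List (Fin k)}
    (huv : u <:+: v) (hv : v ∈ lang Y) : u ∈ lang Y := by
  obtain ⟨s, t, rfl⟩ := huv
  obtain ⟨x, hx, h⟩ := hv
  refine ⟨shift^[s.length] x, mapsTo_iterate_shift hY _ hx, ?_⟩
  exact (word_eq_append (word_eq_append h).1 ).2

theorem coe_iterate_subshiftMap {Y : Set (SymbSpace k)} (hY : MapsTo shift Y Y) (n : ℕ) (x : Y) :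
    ((subshiftMap hY)^[n] x : SymbSpace k) = shift^[n] x := by
  induction n with
  | zero => rfl
  | succ n ih =>
    rw [Function.iterate_succ_apply', Function.iterate_succ_apply', ← ih]
    rfl

theorem exists_word_subset_of_isOpen_subtype {Y : Set (SymbSpace k)} {U : Set Y} (hU : IsOpen U)
    {x : Y} (hx : x ∈ U) : ∃ n, ∀ y : Y, word (y : SymbSpace k) n = word x n → y ∈ U := by
  obtain ⟨V, hV, rfl⟩ := isOpen_induced_iff.1 hU
  obtain ⟨n, hn⟩ := exists_word_subset_of_isOpen hV hx
  exact ⟨n, fun y hy => hn y hy⟩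

/-- A subshift is mixing if any two prefixes occur at all sufficiently large distances. -/
theorem isMixing_subshiftMap {Y : Set (SymbSpace k)} (hY : MapsTo shift Y Y)
    (h : ∀ u ∈ lang Y, ∀ v ∈ lang Y, ∃ N, ∀ n ≥ N, ∃ z ∈ Y, word z u.length = u ∧
      word (shift^[n] z) v.length = v) : IsMixing (subshiftMap hY) := by
  rintro U V hU hV ⟨x, hx⟩ ⟨y, hy⟩
  obtain ⟨m, hm⟩ := exists_word_subset_of_isOpen_subtype hU hx
  obtain ⟨l, hl⟩ := exists_word_subset_of_isOpen_subtype hV hy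
  obtain ⟨N, hN⟩ := h _ (word_mem_lang x.2 m) _ (word_mem_lang y.2 l)
  refine ⟨N, fun n hn => ?_⟩
  obtain ⟨z, hz, hzu, hzv⟩ := hN n hn
  rw [length_word] at hzu hzv
  refine ⟨_, ⟨⟨z, hz⟩, hm _ hzu, rfl⟩, hl _ ?_⟩
  rw [coe_iterate_subshiftMap]
  exact hzv

/-- Any word of `T` can be followed by any word `v` of `T` within a word of `T`, at every distance
above a bound which depends only on `v`. -/
def HasUniformGluing (T : Set (List (Fin k))) : Prop :=
  ∀ v ∈ T, ∃ g, ∀ u ∈ T, ∀ n ≥ g, ∃ m : List (Fin k), m.length = n ∧ u ++ m ++ v ∈ T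

theorem HasUniformGluing.isMixing {Y : Set (SymbSpace k)} (h : HasUniformGluing (lang Y))
    (hY : MapsTo shift Y Y) : IsMixing (subshiftMap hY) := by
  refine isMixing_subshiftMap hY fun u hu v hv => ?_
  obtain ⟨g, hg⟩ := h v hv
  refine ⟨u.length + g, fun n hn => ?_⟩
  obtain ⟨m, hm, z, hz, hzw⟩ := hg u hu (n - u.length) (by omega)
  obtain ⟨h1, h2⟩ := word_eq_append hzw
  refine ⟨z, hz, (word_eq_append h1).1, ?_⟩
  rw [List.length_append, hm, Nat.add_sub_cancel' (by omega)] at h2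
  exact h2

/-- A word of a language with uniform gluing can be repeated periodically. -/
theorem HasUniformGluing.exists_periodic_occurrence {Y : Set (SymbSpace k)}
    (h : HasUniformGluing (lang Y)) (hYc : IsClosed Y) {w : List (Fin k)} (hw : w ∈ lang Y) :
    ∃ n > 0, ∃ z ∈ Y, ∀ j, word (shift^[n * j] z) w.length = w := by
  obtain ⟨g, hg⟩ := h w hw
  -- Since `g` does not depend on the word to be continued, the same gap serves at every repetition;
  -- `g + 1` keeps the period positive even for empty `w`. Finitely many repetitions come by
  -- induction, all of them by compactness.
  refine ⟨w.length + (g + 1), by omega, ?_⟩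
  generalize hn : w.length + (g + 1) = n
  have hstep : ∀ J, ∃ z ∈ Y, ∀ j ≤ J, word (shift^[n * j] z) w.length = w := by
    intro J
    induction J with
    | zero =>
      obtain ⟨z, hz, hzw⟩ := hw
      refine ⟨z, hz, fun j hj => ?_⟩
      rw [Nat.le_zero.1 hj]
      exact hzw
    | succ J ih =>
      obtain ⟨z, hz, hzJ⟩ := ih
      obtain ⟨m, hm, y, hy, hyw⟩ := hg _ (word_mem_lang hz (n * J + w.length)) (g + 1) (by omega)
      obtain ⟨h1, h2⟩ := word_eq_append hyw
      have h1 := (word_eq_append h1).1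
      refine ⟨y, hy, fun j hj => ?_⟩
      rcases Nat.lt_or_ge J j with hJ | hJ
      · obtain rfl : j = J + 1 := by omega
        rw [List.length_append, length_word, hm] at h2
        have : n * (J + 1) = n * J + w.length + (g + 1) := by rw [← hn]; ring
        rw [this]
        exact h2
      · rw [length_word] at h1
        rw [← hzJ j hJ, length_word]
        refine word_eq_iff.2 fun i hi => ?_
        rw [iterate_shift_apply, iterate_shift_apply]
        refine word_eq_iff.1 h1 _ ?_
        have := Nat.mul_le_mul_left n hJ
        omega
  have hcl : ∀ J, IsClosed (Y ∩ ⋂ j ≤ J, {z | word (shift^[n * j] z) w.length = w}) := fun J =>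
    hYc.inter <| isClosed_iInter fun j => isClosed_iInter fun _ =>
      (isClosed_word_mem w.length {w}).preimage (continuous_shift.iterate (n * j))
  obtain ⟨z, hz⟩ := IsCompact.nonempty_iInter_of_sequence_nonempty_isCompact_isClosed _
    (fun J => inter_subset_inter_right _
      (biInter_subset_biInter_left fun j (hj : j ≤ J) => hj.trans J.le_succ))
    (fun J => by
      obtain ⟨z, hz, hzJ⟩ := hstep J
      exact ⟨z, hz, mem_iInter₂.2 hzJ⟩) (hcl 0).isCompact hcl
  rw [mem_iInter] at hz
  exact ⟨z, (hz 0).1, fun j => mem_iInter₂.1 (hz j).2 j le_rfl⟩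

/-- The points showing a given prefix at every multiple of `n` form a closed set inside the cylinder
of that prefix, invariant under the `n`-th iterate. -/
theorem HasUniformGluing.isPeriodicallyDense_hyperMap {Y : Set (SymbSpace k)}
    (h : HasUniformGluing (lang Y)) (hY : MapsTo shift Y Y) (hYc : IsClosed Y) :
    IsPeriodicallyDense (hyperMap (subshiftMap hY) (continuous_subshiftMap hY)) := by
  have : CompactSpace Y := isCompact_iff_compactSpace.1 hYc.isCompact
  refine HyperChaos.isPeriodicallyDense_hyperMap _ fun U hU ⟨x, hx⟩ => ?_
  obtain ⟨m, hm⟩ := exists_word_subset_of_isOpen_subtype hU hx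
  obtain ⟨n, hn, z, hz, hzw⟩ := h.exists_periodic_occurrence hYc (word_mem_lang x.2 m)
  rw [length_word] at hzw
  refine ⟨n, hn, {y : Y | ∀ j, word (shift^[n * j] (y : SymbSpace k)) m = word x m},
    fun y hy => hm y (hy 0), ?_, ⟨⟨z, hz⟩, hzw⟩, fun y hy j => ?_⟩
  · rw [ofPred_forall]
    exact isClosed_iInter fun j => (isClosed_word_mem m {word x.1 m}).preimage
      ((continuous_shift.iterate (n * j)).comp continuous_subtype_val)
  · rw [coe_iterate_subshiftMap, ← Function.iterate_add_apply]
    exact hy (j + 1)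

end Words

/-! ### Bounded gaps and aperiodicity -/

section Minimal

variable {k : ℕ} {X : Set (SymbSpace k)}

theorem IsMinimalSet.exists_occurrence (hX : IsMinimalSet shift X) {v : List (Fin k)}
    (hv : v ∈ lang X) {b : SymbSpace k} (hb : b ∈ X) :
    ∃ p, word (shift^[p] b) v.length = v := by
  obtain ⟨x, hx, hxv⟩ := hv
  rw [← hX.2 b hb, mem_closure_iff_word] at hx
  obtain ⟨_, ⟨p, rfl⟩, hp⟩ := hx v.length
  exact ⟨p, hp.trans hxv⟩

/-- In a minimal subshift every word of the language occurs with bounded gaps. -/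
theorem IsMinimalSet.exists_occurrence_le (hX : IsMinimalSet shift X) (hXc : IsClosed X)
    {v : List (Fin k)} (hv : v ∈ lang X) :
    ∃ g, ∀ b ∈ X, ∃ p ≤ g, word (shift^[p] b) v.length = v := by
  obtain ⟨t, ht⟩ := hXc.isCompact.elim_finite_subcover
    (fun p : ℕ => {b : SymbSpace k | word (shift^[p] b) v.length = v})
    (fun p => (isOpen_word_mem v.length {v}).preimage (continuous_shift.iterate p))
    (fun b hb => mem_iUnion.2 (hX.exists_occurrence hv hb))
  refine ⟨t.sup id, fun b hb => ?_⟩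
  obtain ⟨p, hp, hpb⟩ := mem_iUnion₂.1 (ht hb)
  exact ⟨p, Finset.le_sup (f := id) hp, hpb⟩

/-- The tail after `u` of a point starting with `u` meets `v` within the recurrence bound of `v`.
Only the size of the gap is controlled; in the extension the symbol `2` makes it exact. -/
theorem IsMinimalSet.exists_glue (hX : IsMinimalSet shift X) (hXc : IsClosed X)
    (hXs : MapsTo shift X X) {v : List (Fin k)} (hv : v ∈ lang X) :
    ∃ g, ∀ u ∈ lang X, ∃ m : List (Fin k), m.length ≤ g ∧ u ++ m ++ v ∈ lang X := by
  obtain ⟨g, hg⟩ := hX.exists_occurrence_le hXc hv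
  refine ⟨g, fun u ⟨x, hx, hxu⟩ => ?_⟩
  obtain ⟨p, hp, hpv⟩ := hg _ (mapsTo_iterate_shift hXs u.length hx)
  refine ⟨word (shift^[u.length] x) p, by simpa using hp,
    mem_lang_iff.2 ⟨x, hx, u.length + p + v.length, ?_⟩⟩
  rw [word_add, word_add, hxu, Nat.add_comm, Function.iterate_add_apply, hpv]

/-- A mixing minimal subshift with more than one point has no periodic points. -/
theorem IsMixingNontrivialMinimalSubshift.not_mem_periodicPts
    (hX : IsMixingNontrivialMinimalSubshift X) {y : SymbSpace k} (hy : y ∈ X) :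
    y ∉ Function.periodicPts shift := by
  intro hper
  have hfin : (range fun n : ℕ => shift^[n] y).Finite := by
    obtain ⟨p, hp, hpy⟩ := hper
    refine ((finite_lt_nat p).image fun n => shift^[n] y).subset ?_
    rintro _ ⟨n, rfl⟩
    refine ⟨n % p, Nat.mod_lt _ hp, ?_⟩
    exact hpy.iterate_mod_apply n
  have hXeq := hX.minimal.2 y hy
  rw [hfin.isClosed.closure_eq] at hXeq
  -- A finite `X` is discrete, so mixing makes all late iterates return `y` to itself; two
  -- consecutive returns make `y` a fixed point and `X` a single point.
  have : Finite X := (hXeq ▸ hfin).to_subtype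
  have hopen : IsOpen ({⟨y, hy⟩} : Set X) := isOpen_discrete _
  obtain ⟨N, hN⟩ := hX.mixing _ _ hopen hopen ⟨_, rfl⟩ ⟨_, rfl⟩
  have hret : ∀ n ≥ N, shift^[n] y = y := fun n hn => by
    obtain ⟨_, ⟨_, rfl, rfl⟩, h⟩ := hN n hn
    have h := congrArg Subtype.val (mem_singleton_iff.1 h)
    rwa [coe_iterate_subshiftMap] at h
  have hfix : shift y = y := by
    have := hret (N + 1) (by omega)
    rwa [Function.iterate_succ_apply', hret N le_rfl] at this
  refine hX.nontrivial.not_subsingleton (hXeq ▸ ?_)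
  rintro _ ⟨m, rfl⟩ _ ⟨n, rfl⟩
  simp only [Function.iterate_fixed hfix]

end Minimal

/-! ### The extension by the symbol `2` -/

section Extension

/-- Delete the symbol `2` from a word. -/
def strip (w : List (Fin 3)) : List (Fin 2) :=
  w.filterMap fun a => if h : a.val < 2 then some ⟨a.val, h⟩ else none

@[simp] theorem strip_nil : strip [] = [] := rfl

@[simp] theorem strip_two_cons (w : List (Fin 3)) : strip (2 :: w) = strip w := by
  simp [strip]

@[simp] theorem strip_castSucc_cons (c : Fin 2) (w : List (Fin 3)) :
    strip (c.castSucc :: w) = c :: strip w :=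
  List.filterMap_cons_some (dif_pos c.is_lt)

@[simp] theorem strip_append (v w : List (Fin 3)) : strip (v ++ w) = strip v ++ strip w := by
  simp [strip]

@[simp] theorem strip_replicate_two (n : ℕ) : strip (List.replicate n 2) = [] := by
  induction n with
  | zero => rfl
  | succ n ih => rw [List.replicate_succ, strip_two_cons, ih]

@[simp] theorem strip_map_castSucc (u : List (Fin 2)) : strip (u.map Fin.castSucc) = u := by
  induction u with
  | nil => rfl
  | cons c u ih => rw [List.map_cons, strip_castSucc_cons, ih]

theorem eq_two_or_eq_castSucc (a : Fin 3) : a = 2 ∨ ∃ c : Fin 2, a = c.castSucc := by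
  decide +revert

/-- Put the symbol `a` in front of the sequence `x`. -/
def consSeq {k : ℕ} (a : Fin k) (x : SymbSpace k) : SymbSpace k
  | 0 => a
  | n + 1 => x n

theorem word_consSeq {k : ℕ} (a : Fin k) (x : SymbSpace k) (n : ℕ) :
    word (consSeq a x) (n + 1) = a :: word x n := by
  rw [word_succ]
  rfl

theorem map_castSucc_mem_extension (b : SymbSpace 2) :
    (fun n => (b n).castSucc : SymbSpace 3) ∈ extension b :=
  ⟨id, strictMono_id, fun _ => rfl, fun m hm => absurd ⟨m, rfl⟩ hm⟩

theorem two_consSeq_mem_extension {b : SymbSpace 2} {x : SymbSpace 3} (hx : x ∈ extension b) :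
    consSeq 2 x ∈ extension b := by
  obtain ⟨ν, hν, hb, h2⟩ := hx
  refine ⟨fun i => ν i + 1, fun i j hij => Nat.succ_lt_succ (hν hij), hb, fun m hm => ?_⟩
  cases m with
  | zero => rfl
  | succ m => exact h2 m fun ⟨i, hi⟩ => hm ⟨i, congrArg (· + 1) hi⟩

theorem castSucc_consSeq_mem_extension {b : SymbSpace 2} {x : SymbSpace 3}
    (hx : x ∈ extension (shift b)) : consSeq (b 0).castSucc x ∈ extension b := by
  obtain ⟨ν, hν, hb, h2⟩ := hx
  refine ⟨fun i => Nat.casesOn i 0 fun i => ν i + 1, strictMono_nat_of_lt_succ fun i => ?_,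
    fun i => ?_, fun m hm => ?_⟩
  · cases i with
    | zero => exact Nat.succ_pos _
    | succ i => exact Nat.succ_lt_succ (hν i.lt_succ_self)
  · cases i with
    | zero => rfl
    | succ i => exact hb i
  · cases m with
    | zero => exact absurd ⟨0, rfl⟩ hm
    | succ m => exact h2 m fun ⟨i, hi⟩ => hm ⟨i + 1, congrArg (· + 1) hi⟩

theorem exists_mem_extension_of_strip_eq {w : List (Fin 3)} {b : SymbSpace 2} {m : ℕ}
    (h : strip w = word b m) : ∃ x ∈ extension b, word x w.length = w := by
  induction w generalizing b m with
  | nil => exact ⟨_, map_castSucc_mem_extension b, rfl⟩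
  | cons a w ih =>
    rcases eq_two_or_eq_castSucc a with rfl | ⟨c, rfl⟩
    · rw [strip_two_cons] at h
      obtain ⟨x, hx, hxw⟩ := ih h
      exact ⟨_, two_consSeq_mem_extension hx, by rw [List.length_cons, word_consSeq, hxw]⟩
    · rw [strip_castSucc_cons] at h
      cases m with
      | zero => exact absurd h (List.cons_ne_nil _ _)
      | succ m =>
        rw [word_succ, List.cons.injEq] at h
        obtain ⟨rfl, h⟩ := h
        obtain ⟨x, hx, hxw⟩ := ih h
        exact ⟨_, castSucc_consSeq_mem_extension hx, by rw [List.length_cons, word_consSeq, hxw]⟩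

theorem exists_strip_word_eq {b : SymbSpace 2} {x : SymbSpace 3} (hx : x ∈ extension b) (n : ℕ) :
    ∃ m, strip (word x n) = word b m := by
  obtain ⟨ν, hν, hb, h2⟩ := hx
  -- The induction needs to know that `m` counts the positions `ν i` below `n`.
  suffices h : ∃ m, strip (word x n) = word b m ∧ ∀ i, i < m ↔ ν i < n from
    ⟨h.choose, h.choose_spec.1⟩
  induction n with
  | zero => exact ⟨0, rfl, by simp⟩
  | succ n ih =>
    obtain ⟨m, hm, hlt⟩ := ih
    rw [word_succ', strip_append, hm]
    by_cases hn : n ∈ range ν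
    · obtain ⟨j, rfl⟩ := hn
      simp only [hν.lt_iff_lt] at hlt
      obtain rfl : m = j := by
        have h1 := hlt j
        have h2 := hlt m
        omega
      refine ⟨m + 1, ?_, fun i => ?_⟩
      · rw [hb, strip_castSucc_cons, strip_nil, word_succ']
      · rw [Nat.lt_succ_iff, Nat.lt_succ_iff, hν.le_iff_le]
    · refine ⟨m, ?_, fun i => ?_⟩
      · rw [h2 n hn, strip_two_cons, strip_nil, List.append_nil]
      · have : ν i ≠ n := fun h => hn ⟨i, h⟩
        rw [hlt]
        omega

/-- The closure adds no new prefixes, and inserting `2`s is unrestricted, so only the stripped word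
matters. -/
theorem mem_lang_tilde_iff {X : Set (SymbSpace 2)} {w : List (Fin 3)} :
    w ∈ lang (tilde X) ↔ strip w ∈ lang X := by
  constructor
  · rintro ⟨x, hx, hxw⟩
    obtain ⟨y, hy, hyx⟩ := mem_closure_iff_word.1 hx w.length
    obtain ⟨b, hb, hy⟩ := mem_iUnion₂.1 hy
    obtain ⟨m, hm⟩ := exists_strip_word_eq hy w.length
    rw [← hxw, ← hyx, hm]
    exact word_mem_lang hb m
  · rintro ⟨b, hb, hbw⟩
    obtain ⟨x, hx, hxw⟩ := exists_mem_extension_of_strip_eq hbw.symm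
    exact ⟨x, subset_closure (mem_biUnion hb hx), hxw⟩

theorem hasUniformGluing_tilde {X : Set (SymbSpace 2)} (hX : IsMinimalSet shift X)
    (hXc : IsClosed X) (hXs : MapsTo shift X X) : HasUniformGluing (lang (tilde X)) := by
  intro v hv
  rw [mem_lang_tilde_iff] at hv
  obtain ⟨g, hg⟩ := hX.exists_glue hXc hXs hv
  refine ⟨g, fun u hu n hn => ?_⟩
  obtain ⟨m, hm, hmem⟩ := hg _ (mem_lang_tilde_iff.1 hu)
  refine ⟨m.map Fin.castSucc ++ List.replicate (n - m.length) 2, ?_, mem_lang_tilde_iff.2 ?_⟩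
  · simp
    omega
  · simpa using hmem

theorem nontrivial_tilde {X : Set (SymbSpace 2)} (hX : X.Nonempty) : Nontrivial (tilde X) := by
  obtain ⟨b, hb⟩ := hX
  have h := map_castSucc_mem_extension b
  refine ⟨⟨⟨_, subset_closure (mem_biUnion hb h)⟩,
    ⟨_, subset_closure (mem_biUnion hb (two_consSeq_mem_extension h))⟩, fun heq => ?_⟩⟩
  have := congrFun (congrArg Subtype.val heq) 0
  exact (b 0).castSucc_lt_last.ne this

/-- Deleting the symbols `2` from a periodic point of the extension gives a periodic point. -/
theorem exists_mem_periodicPts_of_tilde {X : Set (SymbSpace 2)} (hXc : IsClosed X)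
    {x : SymbSpace 3} (hx : x ∈ tilde X) (hper : x ∈ Function.periodicPts shift) (hx0 : x 0 ≠ 2) :
    ∃ y ∈ X, y ∈ Function.periodicPts shift := by
  obtain ⟨p, hp, hpx⟩ := hper
  -- The candidate is `u` repeated forever; `u` is nonempty because `x` does not start with `2`.
  -- Stripping whole periods of `x` yields arbitrarily long prefixes of it, all in the language of
  -- `X`.
  set u := strip (word x p) with hu
  have hlen : 0 < u.length := by
    obtain ⟨p, rfl⟩ := Nat.exists_eq_add_of_le' hp
    obtain ⟨c, hc⟩ := (eq_two_or_eq_castSucc (x 0)).resolve_left hx0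
    rw [hu, word_succ, hc, strip_castSucc_cons]
    simp
  let y : SymbSpace 2 := fun n => u[n % u.length]'(Nat.mod_lt _ hlen)
  have hyper : shift^[u.length] y = y := by
    funext n
    rw [iterate_shift_apply]
    simp only [y, Nat.add_mod_left]
  have hyu : word y u.length = u := by
    refine List.ext_getElem (length_word _ _) fun i h1 h2 => ?_
    simp [word, y, Nat.mod_eq_of_lt h2]
  have hrep : ∀ j, strip (word x (p * j)) = word y (u.length * j) := by
    intro j
    induction j with
    | zero => rfl
    | succ j ih =>
      rw [Nat.mul_succ, Nat.mul_succ, Nat.add_comm, Nat.add_comm _ u.length, word_add, word_add,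
        strip_append, hpx.eq, ih, hyper, hyu]
  refine ⟨y, mem_of_forall_word_mem_lang hXc fun n => ?_, u.length, hlen, hyper⟩
  obtain ⟨b, hb, m, hm⟩ := mem_lang_iff.1 (mem_lang_tilde_iff.1 (word_mem_lang hx (p * n)))
  rw [hrep] at hm
  obtain rfl : m = u.length * n := by simpa using congrArg List.length hm
  rw [← word_eq_of_le (Nat.le_mul_of_pos_left n hlen) hm]
  exact word_mem_lang hb n

theorem not_isPeriodicallyDense_tildeShift {X : Set (SymbSpace 2)}
    (hX : IsMixingNontrivialMinimalSubshift X) :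
    ¬ IsPeriodicallyDense (tildeShift hX.mapsTo) := by
  intro hdense
  obtain ⟨b, hb⟩ := hX.minimal.1
  have hopen : IsOpen {x : tilde X | word (x : SymbSpace 3) 1 ∈ {w | w ≠ [2]}} :=
    (isOpen_word_mem 1 {w | w ≠ [2]}).preimage continuous_subtype_val
  obtain ⟨x, hx, p, hp, hpx⟩ := (dense_iff_inter_open.1 hdense) _ hopen
    ⟨⟨_, subset_closure (mem_biUnion hb (map_castSucc_mem_extension b))⟩, fun h =>
      (b 0).castSucc_lt_last.ne (List.head_eq_of_cons_eq h)⟩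
  obtain ⟨y, hy, hyper⟩ := exists_mem_periodicPts_of_tilde hX.isClosed x.2
    ⟨p, hp, (coe_iterate_subshiftMap _ p x).symm.trans (congrArg Subtype.val hpx)⟩
    fun h => hx (congrArg (fun a => [a]) h)
  exact hX.not_mem_periodicPts hy hyper

theorem isDevaneyChaotic_hyperMap_tildeShift {X : Set (SymbSpace 2)}
    (hX : IsMinimalSet shift X) (hXc : IsClosed X) (hXs : MapsTo shift X X) :
    IsDevaneyChaotic (hyperMap (tildeShift hXs) (continuous_tildeShift hXs)) := by
  have hglue := hasUniformGluing_tilde hX hXc hXs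
  have hmix := (hglue.isMixing (mapsTo_shift_tilde hXs)).hyperMap (continuous_subshiftMap _)
  have := nontrivial_tilde hX.1
  have : Nontrivial (NonemptyCompacts (tilde X)) := by
    obtain ⟨x, y, hxy⟩ := exists_pair_ne (tilde X)
    exact ⟨{x}, {y}, fun h => hxy (singleton_injective (congrArg SetLike.coe h))⟩
  exact ⟨hmix.isTransitive, hglue.isPeriodicallyDense_hyperMap _ isClosed_closure,
    hmix.isSensitive⟩

end Extension

/-! ### Powers and concatenations of words -/

section Repetition

variable {α : Type*}

/-- The concatenation of `n` copies of the word `w`. -/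
def rep (w : List α) (n : ℕ) : List α := (List.replicate n w).flatten

@[simp] theorem rep_zero (w : List α) : rep w 0 = [] := rfl

theorem rep_succ (w : List α) (n : ℕ) : rep w (n + 1) = w ++ rep w n := by
  simp [rep, List.replicate_succ]

@[simp] theorem length_rep (w : List α) (n : ℕ) : (rep w n).length = n * w.length := by
  simp [rep]

theorem rep_add (w : List α) (m n : ℕ) : rep w (m + n) = rep w m ++ rep w n := by
  simp only [rep, List.replicate_add, List.flatten_append]

theorem rep_split (w : List α) {i n : ℕ} (h : i < n) :
    rep w n = rep w i ++ w ++ rep w (n - i - 1) := by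
  obtain ⟨d, rfl⟩ := Nat.exists_eq_add_of_lt h
  rw [Nat.add_assoc, rep_add, rep_succ, List.append_assoc]
  congr
  omega

theorem infix_rep (w : List α) {n : ℕ} (h : 0 < n) : w <:+: rep w n :=
  ⟨[], rep w (n - 1), by rw [rep_split w h]; rfl⟩

theorem rep_append_succ (u v : List α) (n : ℕ) :
    rep (u ++ v) (n + 1) = u ++ rep (v ++ u) n ++ v := by
  induction n with
  | zero => simp [rep_succ]
  | succ n ih => rw [rep_succ, ih, rep_succ (v ++ u)]; simp only [List.append_assoc]

/-- A long factor of a concatenation of short words contains one of these words. -/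
theorem exists_infix_of_infix_flatten {h : ℕ} {Ls : List (List α)} (hLs : ∀ w ∈ Ls, w.length ≤ h)
    {v : List α} (hv : v <:+: Ls.flatten) (hlen : 2 * h < v.length) : ∃ w ∈ Ls, w <:+: v := by
  obtain ⟨s, t, hst⟩ := hv
  induction Ls generalizing s with
  | nil =>
    have := congrArg List.length hst
    simp only [List.length_append, List.flatten_nil, List.length_nil] at this
    omega
  | cons w Ls ih =>
    rw [List.flatten_cons, List.append_assoc] at hst
    have hw := hLs w List.mem_cons_self
    rcases List.append_eq_append_iff.1 hst with ⟨a, rfl, ha⟩ | ⟨c, rfl, hc⟩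
    · cases Ls with
      | nil =>
        have := congrArg List.length ha
        simp only [List.length_append, List.flatten_nil, List.length_nil] at this hw
        omega
      | cons w' Ls =>
        have hw' := hLs w' (by simp)
        refine ⟨w', by simp, ?_⟩
        rw [List.flatten_cons, ← List.append_assoc] at ha
        have hpre : a ++ w' <+: v :=
          List.prefix_of_prefix_length_le ⟨_, ha.symm⟩ ⟨t, rfl⟩
            (by rw [List.length_append] at hw ⊢; omega)
        exact (List.suffix_append a w').isInfix.trans hpre.isInfix
    · obtain ⟨w', hw', hinf⟩ := ih (fun w' hw' => hLs w' (List.mem_cons_of_mem _ hw')) c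
        (by rw [List.append_assoc, hc])
      exact ⟨w', List.mem_cons_of_mem _ hw', hinf⟩

/-- `w` is a concatenation of words from `S`. -/
def IsConcat (S : Set (List α)) (w : List α) : Prop :=
  ∃ Ls : List (List α), (∀ u ∈ Ls, u ∈ S) ∧ Ls.flatten = w

theorem isConcat_of_mem {S : Set (List α)} {w : List α} (h : w ∈ S) : IsConcat S w :=
  ⟨[w], by simpa using h, by simp⟩

theorem IsConcat.append {S : Set (List α)} {v w : List α} (hv : IsConcat S v)
    (hw : IsConcat S w) : IsConcat S (v ++ w) := by
  obtain ⟨Ls, hLs, rfl⟩ := hv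
  obtain ⟨Ms, hMs, rfl⟩ := hw
  exact ⟨Ls ++ Ms, fun u hu => (List.mem_append.1 hu).elim (hLs u) (hMs u), List.flatten_append⟩

theorem IsConcat.rep {S : Set (List α)} {w : List α} (hw : IsConcat S w) (n : ℕ) :
    IsConcat S (rep w n) := by
  induction n with
  | zero => exact ⟨[], by simp, rfl⟩
  | succ n ih => rw [rep_succ]; exact hw.append ih

end Repetition

/-! ### The rank-two blocks and their distances -/

section Blocks

/-- The pair of blocks of each level of a mixing minimal rank-two construction. The length of the
second block is one more than the length of the first one. -/
def blocks : ℕ → List (Fin 2) × List (Fin 2)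
  | 0 => ([0], [1, 1])
  | n + 1 =>
    let A := (blocks n).1
    let B := (blocks n).2
    -- Trading one `A` for one `B` keeps the length difference equal to one. Each block starts with
    -- its predecessor, and the runs leave room for the index choices in `blocksAtDistance_of_le`.
    (rep A (10 * (A.length + 1)) ++ rep B (2 * (A.length + 1)),
      rep B (2 * (A.length + 1) + 1) ++ rep A (10 * (A.length + 1) - 1))

/-- The first block of level `n`. -/
def aBlock (n : ℕ) : List (Fin 2) := (blocks n).1

/-- The second block of level `n`. -/
def bBlock (n : ℕ) : List (Fin 2) := (blocks n).2

theorem aBlock_succ (n : ℕ) : aBlock (n + 1) = rep (aBlock n) (10 * ((aBlock n).length + 1)) ++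
    rep (bBlock n) (2 * ((aBlock n).length + 1)) := rfl

theorem bBlock_succ (n : ℕ) : bBlock (n + 1) = rep (bBlock n) (2 * ((aBlock n).length + 1) + 1) ++
    rep (aBlock n) (10 * ((aBlock n).length + 1) - 1) := rfl

theorem length_bBlock (n : ℕ) : (bBlock n).length = (aBlock n).length + 1 := by
  induction n with
  | zero => rfl
  | succ n ih =>
    rw [aBlock_succ, bBlock_succ]
    simp only [List.length_append, length_rep, ih]
    obtain ⟨c, hc⟩ : ∃ c, 10 * ((aBlock n).length + 1) = c + 1 := ⟨_, rfl⟩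
    rw [hc, Nat.add_sub_cancel]
    ring

theorem length_aBlock_succ (n : ℕ) : (aBlock (n + 1)).length =
    10 * ((aBlock n).length + 1) * (aBlock n).length +
      2 * ((aBlock n).length + 1) * ((aBlock n).length + 1) := by
  rw [aBlock_succ]
  simp only [List.length_append, length_rep, length_bBlock]

theorem lt_length_aBlock (n : ℕ) : n < (aBlock n).length := by
  induction n with
  | zero => decide
  | succ n ih =>
    rw [length_aBlock_succ]
    nlinarith

theorem aBlock_prefix_succ (n : ℕ) : aBlock n <+: aBlock (n + 1) := by
  rw [aBlock_succ, rep_split (i := 0) _ (by omega), rep_zero, List.nil_append, List.append_assoc]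
  exact List.prefix_append _ _

theorem bBlock_prefix_succ (n : ℕ) : bBlock n <+: bBlock (n + 1) := by
  rw [bBlock_succ, rep_succ, List.append_assoc]
  exact List.prefix_append _ _

theorem aBlock_prefix {m n : ℕ} (h : m ≤ n) : aBlock m <+: aBlock n :=
  Nat.le_induction (List.prefix_refl _) (fun n _ ih => ih.trans (aBlock_prefix_succ n)) n h

theorem aBlock_infix_bBlock_succ (n : ℕ) : aBlock n <:+: bBlock (n + 1) := by
  rw [bBlock_succ]
  exact (infix_rep _ (by omega)).trans (List.suffix_append _ _).isInfix

/-- The factors of the blocks. -/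
def blockLang : Set (List (Fin 2)) := {u | ∃ n, u <:+: aBlock n}

theorem blockLang_of_infix {u v : List (Fin 2)} (huv : u <:+: v) (hv : v ∈ blockLang) :
    u ∈ blockLang :=
  hv.imp fun _ h => huv.trans h

theorem exists_le_infix_aBlock {u : List (Fin 2)} (hu : u ∈ blockLang) (m : ℕ) :
    ∃ n ≥ m, u <:+: aBlock n := by
  obtain ⟨n, hn⟩ := hu
  exact ⟨max n m, le_max_right _ _, hn.trans (aBlock_prefix (le_max_left _ _)).isInfix⟩

theorem isConcat_blocks {m n : ℕ} (h : m ≤ n) :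
    IsConcat {aBlock m, bBlock m} (aBlock n) ∧ IsConcat {aBlock m, bBlock m} (bBlock n) := by
  induction n, h using Nat.le_induction with
  | base => exact ⟨isConcat_of_mem (by simp), isConcat_of_mem (by simp)⟩
  | succ n _ ih =>
    rw [aBlock_succ, bBlock_succ]
    exact ⟨(ih.1.rep _).append (ih.2.rep _), (ih.2.rep _).append (ih.1.rep _)⟩

/-- Every word occurs in all long words. -/
theorem exists_forall_infix_of_mem_blockLang {u : List (Fin 2)} (hu : u ∈ blockLang) :
    ∃ g, ∀ v ∈ blockLang, g ≤ v.length → u <:+: v := by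
  obtain ⟨m, hm⟩ := hu
  refine ⟨2 * (bBlock (m + 1)).length + 1, fun v hv hlen => ?_⟩
  obtain ⟨n, hn, hvn⟩ := exists_le_infix_aBlock hv (m + 1)
  obtain ⟨Ls, hLs, hflat⟩ := (isConcat_blocks hn).1
  rw [← hflat] at hvn
  obtain ⟨w, hw, hwv⟩ := exists_infix_of_infix_flatten (h := (bBlock (m + 1)).length)
    (fun w hw => by
      rcases hLs w hw with rfl | rfl
      · rw [length_bBlock]; omega
      · exact le_rfl) hvn hlen
  refine hm.trans (List.IsInfix.trans ?_ hwv)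
  rcases hLs w hw with rfl | rfl
  · exact (aBlock_prefix_succ m).isInfix
  · exact aBlock_infix_bBlock_succ m

/-- The first and the second block of level `n` occur at distance `d`. -/
def BlocksAtDistance (n d : ℕ) : Prop :=
  ∃ m, aBlock n ++ m ++ bBlock n ∈ blockLang ∧ (aBlock n).length + m.length = d

/-- Blocks begin with their predecessors, so starting positions, and hence distances, are inherited.
-/
theorem BlocksAtDistance.of_succ {n d : ℕ} (h : BlocksAtDistance (n + 1) d) :
    BlocksAtDistance n d := by
  obtain ⟨m, hm, hd⟩ := h
  obtain ⟨a, ha⟩ := aBlock_prefix_succ n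
  obtain ⟨b, hb⟩ := bBlock_prefix_succ n
  rw [← ha, ← hb] at hm
  refine ⟨a ++ m, blockLang_of_infix ⟨[], b, ?_⟩ hm, ?_⟩
  · simp only [List.append_assoc, List.nil_append]
  · rw [← hd, ← ha, List.length_append, List.length_append, Nat.add_assoc]

theorem blocksAtDistance_of_mem {n P Q i j d : ℕ} {M : List (Fin 2)}
    (hmem : rep (aBlock n) P ++ M ++ rep (bBlock n) Q ∈ blockLang) (hi : i < P) (hj : j < Q)
    (hd : d + i * (aBlock n).length =
      P * (aBlock n).length + M.length + j * ((aBlock n).length + 1)) :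
    BlocksAtDistance n d := by
  refine ⟨rep (aBlock n) (P - i - 1) ++ M ++ rep (bBlock n) j, blockLang_of_infix
    ⟨rep (aBlock n) i, rep (bBlock n) (Q - j - 1), ?_⟩ hmem, ?_⟩
  · rw [rep_split _ hi, rep_split _ hj]
    simp only [List.append_assoc]
  · simp only [List.length_append, length_rep, length_bBlock]
    obtain ⟨c, rfl⟩ := Nat.exists_eq_add_of_lt hi
    have : i + c + 1 - i - 1 = c := by omega
    rw [this]
    linarith

theorem rep_aBlock_mem_blockLang (n : ℕ) {m : ℕ} (hm : m ≤ (aBlock n).length + 1) :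
    rep (aBlock n) m ++ bBlock n ∈ blockLang := by
  refine ⟨n + 1, ?_⟩
  rw [aBlock_succ]
  obtain ⟨d, hd⟩ := Nat.exists_eq_add_of_le' (hm.trans (show _ ≤ 10 * ((aBlock n).length + 1) by omega))
  rw [hd, rep_add, rep_split (i := 0) (bBlock n) (by omega)]
  exact ⟨rep (aBlock n) d, rep (bBlock n) (2 * ((aBlock n).length + 1) - 0 - 1), by
    simp only [rep_zero, List.append_assoc, List.nil_append]⟩

/-- With `aBlock (n + 1) = U ++ V`, its power `m + 1` is `U (VU)^m V`: the distance runs from copy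
`i` of `aBlock n` in the first `U` to copy `j` of `bBlock n` in the last `V`. -/
theorem blocksAtDistance_add {n m i j d : ℕ} (hm : m ≤ (aBlock (n + 1)).length)
    (hi : i < 10 * ((aBlock n).length + 1)) (hj : j < 2 * ((aBlock n).length + 1))
    (hd : d + i * (aBlock n).length = m * (aBlock (n + 1)).length +
      10 * ((aBlock n).length + 1) * (aBlock n).length + j * ((aBlock n).length + 1)) :
    BlocksAtDistance n d := by
  set U := rep (aBlock n) (10 * ((aBlock n).length + 1)) with hU
  set V := rep (bBlock n) (2 * ((aBlock n).length + 1)) with hV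
  have hmem := blockLang_of_infix (List.prefix_append _ _).isInfix
    (rep_aBlock_mem_blockLang (n + 1) (Nat.succ_le_succ hm))
  rw [aBlock_succ, rep_append_succ, ← hU, ← hV] at hmem
  refine blocksAtDistance_of_mem hmem hi hj ?_
  have : (V ++ U).length = (aBlock (n + 1)).length := by
    rw [aBlock_succ, List.length_append, List.length_append, Nat.add_comm]
  rw [length_rep, this]
  linarith

/-- Here the target is copy `j` in the run that opens the `bBlock (n + 1)` following `m + 1` copies
of `aBlock (n + 1)`. -/
theorem blocksAtDistance_of_mul_add {n m i j d : ℕ} (hm : m ≤ (aBlock (n + 1)).length)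
    (hi : i < 10 * ((aBlock n).length + 1)) (hj : j < 2 * ((aBlock n).length + 1) + 1)
    (hd : d + i * (aBlock n).length = (m + 1) * (aBlock (n + 1)).length +
      j * ((aBlock n).length + 1)) :
    BlocksAtDistance n d := by
  set U := rep (aBlock n) (10 * ((aBlock n).length + 1)) with hU
  set V := rep (bBlock n) (2 * ((aBlock n).length + 1)) with hV
  have hmem := rep_aBlock_mem_blockLang (n + 1) (Nat.succ_le_succ hm)
  have hUV : aBlock (n + 1) = U ++ V := aBlock_succ n
  rw [rep_succ, bBlock_succ, hUV] at hmem
  refine blocksAtDistance_of_mem (M := V ++ rep (U ++ V) m) (blockLang_of_infix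
    ⟨[], rep (aBlock n) (10 * ((aBlock n).length + 1) - 1), ?_⟩ hmem) hi hj ?_
  · simp only [List.append_assoc, List.nil_append, hU]
  · have hlen : (aBlock (n + 1)).length =
        10 * ((aBlock n).length + 1) * (aBlock n).length + V.length := by
      rw [hUV, List.length_append, hU, length_rep]
    rw [List.length_append, ← hUV, length_rep (aBlock (n + 1))]
    linarith

/-- Write `d = m * L + e` with `e < L`. Raising `j` by one shifts the distance by `1` modulo `l`, so
`j` fixes the residue and `i` corrects the multiple of `l`. The three cases place `e` near the
start, the middle or the end of `[0, L)`. -/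
theorem blocksAtDistance_of_le {n d : ℕ} (h1 : (aBlock n).length ^ 2 ≤ d)
    (h2 : d ≤ (aBlock (n + 1)).length ^ 2) : BlocksAtDistance n d := by
  have hl : 0 < (aBlock n).length := (Nat.zero_le n).trans_lt (lt_length_aBlock n)
  have hLl := length_aBlock_succ n
  have hadd := fun m i j => blocksAtDistance_add (n := n) (m := m) (i := i) (j := j) (d := d)
  have hmul := fun m i j => blocksAtDistance_of_mul_add (n := n) (m := m) (i := i) (j := j) (d := d)
  generalize (aBlock (n + 1)).length = L at *
  generalize (aBlock n).length = l at *
  have hL : 0 < L := by rw [hLl]; positivity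
  have hdm := Nat.div_add_mod d L
  have he := Nat.mod_lt d hL
  have hmL : d / L ≤ L := Nat.div_le_of_le_mul (by linarith [sq L])
  generalize d / L = m at *
  generalize d % L = e at *
  have hqr := Nat.div_add_mod e l
  have hr := Nat.mod_lt e hl
  rcases lt_or_ge e (l ^ 2) with hel | hel
  · have hq : e / l < l := Nat.div_lt_of_lt_mul (by linarith [sq l])
    generalize e / l = q at *
    generalize e % l = r at *
    obtain ⟨m, rfl⟩ : ∃ m', m = m' + 1 := by
      refine Nat.exists_eq_add_of_le' (Nat.pos_of_ne_zero ?_)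
      rintro rfl
      omega
    -- Adding `l` to `j` and `l + 1` to `i` leaves the distance unchanged and keeps `i` nonnegative
    -- when `q > r`.
    refine hmul m (r + l + 1 - q) (r + l) (by omega) (by omega) (by omega) ?_
    obtain ⟨c, rfl⟩ := Nat.exists_eq_add_of_lt hq
    have : r + (q + c + 1) + 1 - q = r + c + 2 := by omega
    rw [this, ← hdm, ← hqr]
    ring
  · rcases le_or_gt e (10 * (l + 1) * l) with heP | heP
    · have hq : e / l ≤ 10 * (l + 1) := Nat.div_le_of_le_mul (by linarith)
      have hq' : l ≤ e / l := (Nat.le_div_iff_mul_le hl).2 (by linarith [sq l])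
      generalize e / l = q at *
      generalize e % l = r at *
      refine hadd m (10 * (l + 1) + r - q) r hmL (by omega) (by omega) ?_
      obtain ⟨c, hc⟩ := Nat.exists_eq_add_of_le hq
      have : 10 * (l + 1) + r - q = c + r := by omega
      rw [this, ← hdm, ← hqr, hc]
      ring
    -- Now `f = L - e` is the deficit of `d` from the next multiple of `L`, and it is shorter than
    -- the final run of `bBlock n`.
    · obtain ⟨f, rfl⟩ := Nat.exists_eq_add_of_le he.le
      have hf : f < 2 * (l + 1) * (l + 1) := by linarith
      have hqr := Nat.div_add_mod f l
      have hr := Nat.mod_lt f hl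
      have hq : f / l < 4 * (l + 1) + 1 :=
        Nat.div_lt_of_lt_mul (by nlinarith)
      generalize f / l = q at *
      generalize f % l = r at *
      refine hmul m (q + 1 + (l - r)) (l - r) hmL (by omega) (by omega) ?_
      obtain ⟨c, rfl⟩ := Nat.exists_eq_add_of_lt hr
      have : r + c + 1 - r = c + 1 := by omega
      rw [this, ← hdm, ← hqr]
      ring

/-- The intervals between squared lengths of consecutive levels cover all large `d`; the distance is
realised at the matching level and passed down to `n`. -/
theorem blocksAtDistance {n d : ℕ} (h : (aBlock n).length ^ 2 ≤ d) : BlocksAtDistance n d := by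
  have hd : d ≤ (aBlock (n + d)).length ^ 2 := by
    have := lt_length_aBlock (n + d)
    nlinarith
  have key : ∀ k n, (aBlock n).length ^ 2 ≤ d → d ≤ (aBlock (n + k)).length ^ 2 →
      BlocksAtDistance n d := by
    intro k
    induction k with
    | zero => exact fun n h h' => blocksAtDistance_of_le h (h'.trans
        (Nat.pow_le_pow_left (aBlock_prefix_succ n).length_le 2))
    | succ k ih =>
      intro n h h'
      rcases le_total d ((aBlock (n + 1)).length ^ 2) with hle | hle
      · exact blocksAtDistance_of_le h hle
      · exact (ih (n + 1) hle (by rwa [Nat.add_right_comm])).of_succ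
  exact key d n h hd

end Blocks

/-! ### The block subshift is mixing, minimal and non-trivial -/

section BlockSubshift

/-- The sequence of which all the blocks `aBlock n` are prefixes. -/
def blockSeq : SymbSpace 2 := fun n => (aBlock n)[n]'(lt_length_aBlock n)

theorem word_blockSeq (n : ℕ) : word blockSeq (aBlock n).length = aBlock n := by
  refine List.ext_getElem (length_word _ _) fun i _ hi => ?_
  simp only [word, List.getElem_map, List.getElem_range, blockSeq]
  rcases le_total i n with h | h
  · exact (aBlock_prefix h).getElem _
  · exact ((aBlock_prefix h).getElem hi).symm

/-- The subshift of the sequences all of whose factors are factors of the blocks. -/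
def blockSubshift : Set (SymbSpace 2) := {x | ∀ n, word x n ∈ blockLang}

theorem isClosed_blockSubshift : IsClosed blockSubshift := by
  rw [blockSubshift, ofPred_forall]
  exact isClosed_iInter fun n => isClosed_word_mem n blockLang

theorem mapsTo_shift_blockSubshift : MapsTo shift blockSubshift blockSubshift := fun x hx n =>
  blockLang_of_infix (word_succ x n ▸ (List.suffix_cons _ _).isInfix) (hx (n + 1))

theorem blockSeq_mem_blockSubshift : blockSeq ∈ blockSubshift := fun n =>
  ⟨n, (word_blockSeq n ▸ word_prefix blockSeq (lt_length_aBlock n).le).isInfix⟩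

theorem lang_blockSubshift : lang blockSubshift = blockLang := by
  ext u
  constructor
  · rintro ⟨x, hx, hxu⟩
    exact hxu ▸ hx u.length
  · rintro ⟨n, hn⟩
    refine lang_of_infix mapsTo_shift_blockSubshift hn ?_
    rw [← word_blockSeq]
    exact word_mem_lang blockSeq_mem_blockSubshift _

theorem isMinimalSet_blockSubshift : IsMinimalSet shift blockSubshift := by
  refine ⟨⟨_, blockSeq_mem_blockSubshift⟩, fun x hx => Subset.antisymm ?_ fun y hy => ?_⟩
  · refine closure_minimal ?_ isClosed_blockSubshift
    rintro _ ⟨n, rfl⟩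
    exact mapsTo_iterate_shift mapsTo_shift_blockSubshift n hx
  · refine mem_closure_iff_word.2 fun n => ?_
    obtain ⟨g, hg⟩ := exists_forall_infix_of_mem_blockLang (hy n)
    obtain ⟨s, t, hst⟩ := hg _ (hx g) (length_word x g).ge
    have h := (word_eq_append (word_eq_append hst.symm).1).2
    rw [length_word] at h
    exact ⟨_, ⟨s.length, rfl⟩, h⟩

theorem nontrivial_blockSubshift : blockSubshift.Nontrivial := by
  have h : ∀ c : Fin 2, ∃ x ∈ blockSubshift, x 0 = c := fun c => by
    have hc : [c] ∈ lang blockSubshift := by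
      rw [lang_blockSubshift]
      refine ⟨1, (List.singleton_infix_iff _ _).2 ?_⟩
      revert c
      decide
    obtain ⟨x, hx, hxc⟩ := hc
    exact ⟨x, hx, List.head_eq_of_cons_eq hxc⟩
  obtain ⟨x, hx, hx0⟩ := h 0
  obtain ⟨y, hy, hy0⟩ := h 1
  refine ⟨x, hx, y, hy, ?_⟩
  rintro rfl
  exact absurd (hx0.symm.trans hy0) (by decide)

theorem isMixing_blockSubshift : IsMixing (subshiftMap mapsTo_shift_blockSubshift) := by
  refine isMixing_subshiftMap _ fun u hu v hv => ?_
  rw [lang_blockSubshift] at hu hv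
  obtain ⟨m, hm⟩ := hu
  obtain ⟨n, hmn, hn⟩ := exists_le_infix_aBlock hv m
  obtain ⟨s, t, hst⟩ := hm.trans (aBlock_prefix (hmn.trans n.le_succ)).isInfix
  obtain ⟨s', t', hst'⟩ := hn.trans (aBlock_infix_bBlock_succ n)
  refine ⟨(aBlock (n + 1)).length ^ 2 + s'.length, fun d hd => ?_⟩
  -- The offsets `s` of `u` in the first block and `s'` of `v` in the second convert the distance of
  -- the words into that of the blocks.
  obtain ⟨w, hw, hlen⟩ := blocksAtDistance (n := n + 1) (d := d + s.length - s'.length) (by omega)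
  have hmem : u ++ (t ++ w ++ s') ++ v ∈ lang blockSubshift := by
    rw [lang_blockSubshift]
    refine blockLang_of_infix ⟨s, t', ?_⟩ hw
    rw [← hst, ← hst']
    simp only [List.append_assoc]
  obtain ⟨z, hz, hzw⟩ := hmem
  obtain ⟨h1, h2⟩ := word_eq_append hzw
  refine ⟨z, hz, (word_eq_append h1).1, ?_⟩
  have hd' : (u ++ (t ++ w ++ s')).length = d := by
    rw [← hst] at hlen
    simp only [List.length_append] at hlen ⊢
    omega
  rwa [hd'] at h2

theorem isMixingNontrivialMinimalSubshift_blockSubshift :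
    IsMixingNontrivialMinimalSubshift blockSubshift where
  isClosed := isClosed_blockSubshift
  mapsTo := mapsTo_shift_blockSubshift
  minimal := isMinimalSet_blockSubshift
  nontrivial := nontrivial_blockSubshift
  mixing := isMixing_blockSubshift

end BlockSubshift

end HyperChaos

theorem mainTheorem1 :
    (∃ X : Set (HyperChaos.SymbSpace 2), HyperChaos.IsMixingNontrivialMinimalSubshift X) ∧
    ∀ (X : Set (HyperChaos.SymbSpace 2)) (hX : HyperChaos.IsMixingNontrivialMinimalSubshift X),
      HyperChaos.IsCompactSystem (HyperChaos.tildeShift hX.mapsTo) ∧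
      HyperChaos.IsDevaneyChaotic
        (HyperChaos.hyperMap (HyperChaos.tildeShift hX.mapsTo)
          (HyperChaos.continuous_tildeShift hX.mapsTo)) ∧
      ¬ HyperChaos.IsDevaneyChaotic (HyperChaos.tildeShift hX.mapsTo) :=
  ⟨⟨_, HyperChaos.isMixingNontrivialMinimalSubshift_blockSubshift⟩, fun _ hX =>
    ⟨⟨isCompact_iff_compactSpace.1 isClosed_closure.isCompact,
      HyperChaos.continuous_tildeShift hX.mapsTo⟩,
    HyperChaos.isDevaneyChaotic_hyperMap_tildeShift hX.minimal hX.isClosed hX.mapsTo,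
    fun h => HyperChaos.not_isPeriodicallyDense_tildeShift hX h.periodicallyDense⟩⟩
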